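/- Let $M$ be a smooth 3-manifold (without boundary), let $L\subset M$ be a knot along which $M$ is orientable, and let $h:D^2\times S^1\cong T\subset M$ be a framed closed tubular neighbourhood of $L=h(0\times S^1)$, where $D^2=(|u|\le 1)\subset\mathbb{C}_u$ and $S^1=(|v|=1)\subset\mathbb{C}_v$; put $N=M\setminus\operatorname{int}T$. For an orientation preserving diffeomorphism $\varphi$ of the torus $\partial T\cong S^1\times S^1$, let $M_\varphi=T\cup_\varphi N$ be the 3-manifold obtained by gluing $x\in\partial T$ to $\varphi(x)\in\partial N$; the passage $M\mapsto M_\varphi$ is called a surgery along $L$. Let $\begin{pmatrix}a&b\\c&d\end{pmatrix}\in SL(2,\mathbb{Z})$ be the matrix of $\varphi$, i.e. $\varphi$ is homotopic (equivalently, isotopic) to $(u,v)\mapsto(u^av^b,u^cv^d)$. The surgery is called trivial mod 2 if $c\equiv 0\bmod 2$, and it is called a topological flop if $c\neq 0$ and its surgery coefficient $a/c\in\mathbb{Q}/\mathbb{Z}$ is congruent to $1/2$ modulo $1$. If $M\mapsto M_1$ is a surgery along $L$ and $M_1\mapsto M_2$ is a surgery made along the solid torus glued in by the first one (with its given identification with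 $D^2\times S^1$), their composite is the surgery $M\mapsto M_2$ along $L$ whose gluing map is the composition of the two gluing maps and whose identification of the exteriors is the composition of the two identifications. Proposition. Every surgery $M\mapsto M'$ that is trivial mod 2 is a composite of finitely many topological flops $M=M_0\mapsto M_1\mapsto\dots\mapsto M_k=M'$, $k\ge 1$. -/

import Mathlib

open scoped Manifold ContDiff Topology

universe u

/-- A smooth 3-manifold: Hausdorff, second countable, without boundary. It need be neither compact
nor connected nor orientable. -/
structure ThreeManifold where
  carrier : Type u
  [topologicalSpace : TopologicalSpace carrier]
  [chartedSpace : ChartedSpace (EuclideanSpace ℝ (Fin 3)) carrier]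
  [isManifold : IsManifold (𝓡 3) ∞ carrier]
  [t2Space : T2Space carrier]
  [secondCountable : SecondCountableTopology carrier]

namespace ThreeManifold

instance : CoeSort ThreeManifold.{u} (Type u) := ⟨carrier⟩

attribute [instance] topologicalSpace chartedSpace isManifold t2Space secondCountable

end ThreeManifold

/-- The torus `(|u| = 1) × (|v| = 1)`. -/
abbrev Torus : Type := Circle × Circle

/-- Diffeomorphisms of the torus. -/
abbrev TorusDiffeo : Type :=
  Torus ≃ₘ^∞⟮(𝓡 1).prod (𝓡 1), (𝓡 1).prod (𝓡 1)⟯ Torus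

/-- The linear self-map `(u, v) ↦ (u ^ a * v ^ b, u ^ c * v ^ d)` of the torus given by the integral
matrix with rows `(a, b)` and `(c, d)`. -/
noncomputable def linearTorusMap (A : Matrix (Fin 2) (Fin 2) ℤ) : C(Torus, Torus) where
  toFun p := (p.1 ^ A 0 0 * p.2 ^ A 0 1, p.1 ^ A 1 0 * p.2 ^ A 1 1)
  continuous_toFun := by fun_prop

/-- `A` is the matrix of the torus diffeomorphism `φ`: the map `φ` is homotopic to the linear map
given by `A`. Equivalently, `φ` acts on `H₁(S¹ × S¹, ℤ) = ℤ²` by `A`. -/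
def HasMatrix (φ : TorusDiffeo) (A : Matrix (Fin 2) (Fin 2) ℤ) : Prop :=
  ContinuousMap.Homotopic (⟨φ, φ.continuous⟩ : C(Torus, Torus)) (linearTorusMap A)

/-- A framed tubular neighbourhood of a knot in a 3-manifold: a smooth open embedding of
`ℂ × S¹`. The knot is the image of `0 × S¹`; the (closed) solid torus is the image of `D² × S¹`, with
`D²` the closed unit disc. That the manifold is orientable along the knot is implied. -/
structure TubularNeighborhood (M : ThreeManifold.{u}) where
  toFun : ℂ × Circle → M
  injective : Function.Injective toFun
  isLocalDiffeomorph : IsLocalDiffeomorph (𝓘(ℝ, ℂ).prod (𝓡 1)) (𝓡 3) ∞ toFun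

namespace TubularNeighborhood

variable {M : ThreeManifold.{u}}

/-- The knot `L`, i.e. the core of the solid torus. -/
def knot (h : TubularNeighborhood M) : Set M := h.toFun '' {p | p.1 = 0}

/-- The closed solid torus `T`. -/
def solidTorus (h : TubularNeighborhood M) : Set M := h.toFun '' {p | ‖p.1‖ ≤ 1}

/-- The interior of `T`. -/
def openSolidTorus (h : TubularNeighborhood M) : Set M := h.toFun '' {p | ‖p.1‖ < 1}

/-- The exterior `N = M \ int T`. -/
def exterior (h : TubularNeighborhood M) : Set M := h.openSolidTorusᶜ

/-- The parametrization of `∂T` by the standard torus. -/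
def boundary (h : TubularNeighborhood M) (x : Torus) : M := h.toFun ((x.1 : ℂ), x.2)

end TubularNeighborhood

/-- A surgery `M₁ ↦ M₂`. Here `T = source.solidTorus` is a solid torus in `M₁`, `N = source.exterior`
is its exterior, and `M₂` is (diffeomorphic to) the manifold `T ∪_φ N` obtained by gluing
`x ∈ ∂T` to `φ x ∈ ∂N = ∂T`: that is, `M₂` is the union of a copy `target.solidTorus` of
`D² × S¹` and of a copy `target.exterior` of `N`, meeting along their boundaries, and
the boundary point `x` of the former is the boundary point `φ x` of the latter. -/
structure Surgery (M₁ M₂ : ThreeManifold.{u}) where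
  /-- the solid torus in `M₁`, with its identification with `D² × S¹` -/
  source : TubularNeighborhood M₁
  /-- the gluing diffeomorphism -/
  φ : TorusDiffeo
  /-- the matrix of `φ`; it has determinant `1` because `φ` preserves the orientation -/
  matrix : Matrix.SpecialLinearGroup (Fin 2) ℤ
  hasMatrix : HasMatrix φ matrix
  /-- the glued-in solid torus in `M₂` -/
  target : TubularNeighborhood M₂
  /-- the diffeomorphism (of manifolds with boundary) between the two exteriors; its values outside
  the exteriors are meaningless -/
  ext : PartialEquiv M₁ M₂
  ext_source : ext.source = source.exterior
  ext_target : ext.target = target.exterior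
  contMDiffOn_ext : ContMDiffOn (𝓡 3) (𝓡 3) ∞ ext ext.source
  contMDiffOn_ext_symm : ContMDiffOn (𝓡 3) (𝓡 3) ∞ ext.symm ext.target
  /-- the gluing along the boundary -/
  glue : ∀ x : Torus, ext (source.boundary (φ x)) = target.boundary x

namespace Surgery

variable {M₁ M₂ M₃ : ThreeManifold.{u}}

/-- The entry `a` of the matrix with rows `(a, b)` and `(c, d)`. -/
def a (S : Surgery M₁ M₂) : ℤ := S.matrix 0 0

/-- The entry `c` of the matrix with rows `(a, b)` and `(c, d)`. -/
def c (S : Surgery M₁ M₂) : ℤ := S.matrix 1 0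

/-- The surgery coefficient `a / c` in `ℚ / ℤ`; it is meaningful only for `c ≠ 0`. -/
def coefficient (S : Surgery M₁ M₂) : AddCircle (1 : ℚ) :=
  (((S.a : ℚ) / (S.c : ℚ) : ℚ) : AddCircle (1 : ℚ))

/-- The surgery is trivial mod 2: `c ≡ 0 mod 2`. -/
def IsTrivialModTwo (S : Surgery M₁ M₂) : Prop := S.c ≡ 0 [ZMOD 2]

/-- The surgery is a topological flop: its coefficient is `1 / 2` modulo `1`. -/
def IsTopologicalFlop (S : Surgery M₁ M₂) : Prop :=
  S.c ≠ 0 ∧ S.coefficient = ((1 / 2 : ℚ) : AddCircle (1 : ℚ))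

/-- `S` is the composite of `S₁ : M₁ ↦ M₂` and `S₂ : M₂ ↦ M₃`: the surgery `S₂` is made along the
solid torus that `S₁` has glued in, the initial and final solid tori of `S` are those of `S₁` and
`S₂`, and the identification of the exteriors is the composite one. (It follows that the gluing
map of `S` is `S₁.φ ∘ S₂.φ`.) -/
structure IsComposite (S₁ : Surgery M₁ M₂) (S₂ : Surgery M₂ M₃) (S : Surgery M₁ M₃) : Prop where
  source_eq : S.source = S₁.source
  middle_eq : S₁.target = S₂.source
  target_eq : S.target = S₂.target
  ext_eq : ∀ x ∈ S.source.exterior, S.ext x = S₂.ext (S₁.ext x)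

/-- `S` is a composite of (finitely many, at least one) topological flops. -/
inductive IsCompositeOfFlops : {M₁ M₂ : ThreeManifold.{u}} → Surgery M₁ M₂ → Prop
  | flop {M₁ M₂ : ThreeManifold.{u}} (S : Surgery M₁ M₂) :
      S.IsTopologicalFlop → IsCompositeOfFlops S
  | comp {M₁ M₂ M₃ : ThreeManifold.{u}} (S₁ : Surgery M₁ M₂) (S₂ : Surgery M₂ M₃)
      (S : Surgery M₁ M₃) :
      IsCompositeOfFlops S₁ → IsCompositeOfFlops S₂ → IsComposite S₁ S₂ S → IsCompositeOfFlops S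

end Surgery

/-!
The gluing matrix of a composite surgery is the product of the gluing matrices, so the statement is
about factoring a matrix with rows `(a, b)`, `(c, d)` and `c` even into matrices of topological
flops, provided each factorization of the matrix can be realized by surgeries with the prescribed
identifications of the exteriors. A matrix in `SL(2, ℤ)` with `c = ± 2` has `a` odd and hence belongs
to a flop.

*Realization* (`Surgery.exists_isComposite`). For any surgery `S : M₁ ↦ M₂` and any matrix `B`, there
is a surgery `S₁ : M₁ ↦ M'` along the same solid torus with linear gluing map `B`
(`Surgery.exists_linear`). Undoing the identification of exteriors of `S₁` and applying that of `S`
gives a surgery `S₂ : M' ↦ M₂` with gluing map `B⁻¹ ∘ φ`, and `S` is the composite of the two. The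
manifold `M'` is put on the same set of points as `M₁`: the complement of the knot keeps its smooth
structure, and the tubular neighbourhood `ℂ × S¹` is reparametrized by the bijection `twist B`, which
extends the linear map of the torus radially and is a diffeomorphism off the core
(`contMDiffOn_twist`). These two pieces overlap in a smooth way and so define a manifold
(`exists_isManifold_of_pieces`); it is Hausdorff because the closed solid torus is compact and is
preserved by the twist.

*Factorization*. Splitting off the flop with rows `(2 m + 1, m)`, `(2, 1)` replaces `c` by
`(2 m + 1) c - 2 a`, which is again even. When `|c| > 2`, the number `m` can be chosen to make `|c|`
smaller (`exists_natAbs_flopMatrix_inv_mul_lt`), and the new `c` is nonzero. This Euclidean algorithm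
ends at `|c| = 2`, which is a flop. If `c = 0` at the outset, splitting off one flop leaves `|c| = 2`.
-/

open Set

/-! ### Manifolds glued from pieces -/

section Gluing

variable {𝕜 E X M ι : Type*} [NontriviallyNormedField 𝕜] [NormedAddCommGroup E] [NormedSpace 𝕜 E]
  [TopologicalSpace M] [ChartedSpace E M] {n : ℕ∞ω}

/-- A transition map between two charts of the glued manifold is smooth. -/
theorem contMDiffOn_transition [IsManifold 𝓘(𝕜, E) n M] {f g : PartialEquiv X M}
    (hs : ContMDiffOn 𝓘(𝕜, E) 𝓘(𝕜, E) n (f.symm.trans g) (f.symm.trans g).source)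
    {e e' : OpenPartialHomeomorph M E} (he : e ∈ atlas E M) (he' : e' ∈ atlas E M) :
    ContMDiffOn 𝓘(𝕜, E) 𝓘(𝕜, E) n
      ((f.trans e.toPartialEquiv).symm.trans (g.trans e'.toPartialEquiv))
      ((f.trans e.toPartialEquiv).symm.trans (g.trans e'.toPartialEquiv)).source := by
  have h1 := contMDiffOn_symm_of_mem_maximalAtlas
    (IsManifold.subset_maximalAtlas (I := 𝓘(𝕜, E)) (n := n) he)
  have h2 := contMDiffOn_of_mem_maximalAtlas
    (IsManifold.subset_maximalAtlas (I := 𝓘(𝕜, E)) (n := n) he')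
  refine h2.comp (hs.comp (h1.mono ?_) ?_) ?_ <;> intro x hx <;> simp at hx ⊢ <;> tauto

omit [ChartedSpace E M] in
theorem isOpen_transition_source {f g : PartialEquiv X M}
    (ho : IsOpen (f.symm.trans g).source)
    (hs : ContinuousOn (f.symm.trans g) (f.symm.trans g).source)
    (e e' : OpenPartialHomeomorph M E) :
    IsOpen ((f.trans e.toPartialEquiv).symm.trans (g.trans e'.toPartialEquiv)).source := by
  have h1 := hs.isOpen_inter_preimage ho e'.open_source
  have h2 := e.symm.continuousOn.isOpen_inter_preimage e.symm.open_source h1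
  convert h2 using 1
  ext x
  simp
  tauto

/-- A set covered by pieces, each identified with an open subset of a manifold `M`, is a manifold
as soon as the transition maps between the pieces are smooth maps with open domain. -/
theorem exists_isManifold_of_pieces [IsManifold 𝓘(𝕜, E) n M] (f : ι → PartialEquiv X M)
    (hcov : ∀ x, ∃ i, x ∈ (f i).source)
    (hopen : ∀ i j, IsOpen ((f i).symm.trans (f j)).source)
    (hsmooth : ∀ i j, ContMDiffOn 𝓘(𝕜, E) 𝓘(𝕜, E) n
      ((f i).symm.trans (f j)) ((f i).symm.trans (f j)).source) :
    ∃ (_ : TopologicalSpace X) (_ : ChartedSpace E X), IsManifold 𝓘(𝕜, E) n X ∧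
      ∀ i, ∃ F : PartialDiffeomorph 𝓘(𝕜, E) 𝓘(𝕜, E) X M n, F.toPartialEquiv = f i := by
  choose k hk using hcov
  let c : ChartedSpaceCore E X :=
    { atlas := {φ | ∃ i, ∃ e ∈ atlas E M, φ = (f i).trans e.toPartialEquiv}
      chartAt := fun x => (f (k x)).trans (chartAt E (f (k x) x)).toPartialEquiv
      mem_chart_source := fun x => by simp [hk x]
      chart_mem_atlas := fun x => ⟨k x, _, chart_mem_atlas E _, rfl⟩
      open_source := by
        rintro _ _ ⟨i, e, he, rfl⟩ ⟨j, e', he', rfl⟩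
        exact isOpen_transition_source (hopen i j) (hsmooth i j).continuousOn e e'
      continuousOn_toFun := by
        rintro _ _ ⟨i, e, he, rfl⟩ ⟨j, e', he', rfl⟩
        exact (contMDiffOn_transition (hsmooth i j) he he').continuousOn }
  let _ : TopologicalSpace X := c.toTopologicalSpace
  let _ : ChartedSpace E X := c.toChartedSpace
  have hatlas : ∀ {φ : PartialEquiv X E} (hφ : φ ∈ c.atlas),
      c.openPartialHomeomorph φ hφ ∈ atlas E X := fun {φ} hφ =>
    mem_iUnion₂.2 ⟨φ, hφ, rfl⟩
  have : IsManifold 𝓘(𝕜, E) n X := by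
    apply isManifold_of_contDiffOn
    rintro φ φ' hφ hφ'
    obtain ⟨_, ⟨i, e, he, rfl⟩, rfl⟩ := mem_iUnion₂.1 hφ
    obtain ⟨_, ⟨j, e', he', rfl⟩, rfl⟩ := mem_iUnion₂.1 hφ'
    have := contMDiffOn_iff_contDiffOn.1 (contMDiffOn_transition (hsmooth i j) he he')
    simp only [modelWithCornersSelf_coe, modelWithCornersSelf_coe_symm, range_id, inter_univ,
      preimage_id]
    exact this
  refine ⟨_, _, this, fun i => ?_⟩
  have hmem : ∀ x : X, (f i).trans (chartAt E (f i x)).toPartialEquiv ∈ c.atlas :=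
    fun x => ⟨i, _, chart_mem_atlas E _, rfl⟩
  have hnhds : ∀ x ∈ (f i).source,
      ((f i).trans (chartAt E (f i x)).toPartialEquiv).source ∈ 𝓝 x := fun x hx =>
    (c.open_source' (hmem x)).mem_nhds (by simp [hx])
  have htarget : IsOpen (f i).target := by
    have := hopen i i
    have h : ((f i).symm.trans (f i)).source = (f i).target := by
      ext x
      simp +contextual
    rwa [h] at this
  refine ⟨⟨f i, ?_, htarget, ?_, ?_⟩, rfl⟩
  · exact isOpen_iff_mem_nhds.2 fun x hx => Filter.mem_of_superset (hnhds x hx) fun y hy => hy.1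
  · intro x hx
    have h1 := contMDiffOn_of_mem_maximalAtlas
      (IsManifold.subset_maximalAtlas (I := 𝓘(𝕜, E)) (n := n) (hatlas (hmem x)))
    have h2 := contMDiffOn_symm_of_mem_maximalAtlas
      (IsManifold.subset_maximalAtlas (I := 𝓘(𝕜, E)) (n := n) (chart_mem_atlas E (f i x)))
    refine ((h2.comp h1 ?_).congr ?_ |>.contMDiffAt (hnhds x hx)).contMDiffWithinAt
    · intro y hy
      exact (chartAt E (f i x)).map_source hy.2
    · intro y hy
      exact ((chartAt E (f i x)).left_inv hy.2).symm
  · intro y hy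
    have hx := (f i).map_target hy
    have h1 := contMDiffOn_symm_of_mem_maximalAtlas
      (IsManifold.subset_maximalAtlas (I := 𝓘(𝕜, E)) (n := n) (hatlas (hmem ((f i).symm y))))
    rw [PartialEquiv.invFun_as_coe]
    set e := chartAt E (f i ((f i).symm y)) with he
    have hye : y ∈ e.source := by
      rw [he, (f i).right_inv hy]
      exact mem_chart_source E y
    have h2 := contMDiffOn_of_mem_maximalAtlas
      (IsManifold.subset_maximalAtlas (I := 𝓘(𝕜, E)) (n := n)
        (chart_mem_atlas E (f i ((f i).symm y))))
    have hU : (f i).target ∩ e.source ∈ 𝓝 y := (htarget.inter e.open_source).mem_nhds ⟨hy, hye⟩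
    refine ((h1.comp (h2.mono inter_subset_right) ?_).congr ?_ |>.contMDiffAt hU).contMDiffWithinAt
    · intro z hz
      refine ⟨e.map_source hz.2, ?_⟩
      change e.symm (e z) ∈ (f i).target
      rw [e.left_inv hz.2]
      exact hz.1
    · intro z hz
      exact congrArg (f i).symm (e.left_inv hz.2).symm

end Gluing

section Topology

variable {X Y ι : Type*} [TopologicalSpace X] [TopologicalSpace Y]

theorem OpenPartialHomeomorph.exists_separation [T2Space Y] (F : OpenPartialHomeomorph X Y)
    {x y : X} (hx : x ∈ F.source) (hy : y ∈ F.source) (hxy : x ≠ y) :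
    ∃ u v : Set X, IsOpen u ∧ IsOpen v ∧ x ∈ u ∧ y ∈ v ∧ Disjoint u v := by
  obtain ⟨u, v, hu, hv, hxu, hyv, huv⟩ := t2_separation (fun h => hxy (F.injOn hx hy h))
  refine ⟨F.source ∩ F ⁻¹' u, F.source ∩ F ⁻¹' v, F.isOpen_inter_preimage hu,
    F.isOpen_inter_preimage hv, ⟨hx, hxu⟩, ⟨hy, hyv⟩, ?_⟩
  exact (huv.preimage F).mono inter_subset_right inter_subset_right

theorem secondCountableTopology_of_openPartialHomeomorph_cover [SecondCountableTopology Y]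
    [Countable ι] (F : ι → OpenPartialHomeomorph X Y) (hcov : ∀ x, ∃ i, x ∈ (F i).source) :
    SecondCountableTopology X := by
  have : ∀ i, SecondCountableTopology (F i).source := fun i =>
    (F i).toHomeomorphSourceTarget.secondCountableTopology
  exact TopologicalSpace.secondCountableTopology_of_countable_cover (fun i => (F i).open_source)
    (iUnion_eq_univ_iff.2 hcov)

end Topology

/-! ### Linear diffeomorphisms of the torus -/

section LinearTorusMap

theorem linearTorusMap_one (p : Torus) : linearTorusMap 1 p = p := by
  simp [linearTorusMap]

theorem linearTorusMap_mul (A B : Matrix (Fin 2) (Fin 2) ℤ) (p : Torus) :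
    linearTorusMap (A * B) p = linearTorusMap A (linearTorusMap B p) := by
  have key : ∀ (x y : Circle) (a b e f g h : ℤ), x ^ (a * e + b * g) * y ^ (a * f + b * h) =
      (x ^ e * y ^ f) ^ a * (x ^ g * y ^ h) ^ b := by
    intro x y a b e f g h
    rw [mul_zpow, mul_zpow, zpow_add, zpow_add, ← zpow_mul, ← zpow_mul, ← zpow_mul, ← zpow_mul,
      mul_comm e, mul_comm f, mul_comm g, mul_comm h]
    exact mul_mul_mul_comm _ _ _ _
  simp [linearTorusMap, Matrix.mul_apply, Fin.sum_univ_two, key]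

theorem contMDiff_circle_zpow (k : ℤ) : ContMDiff (𝓡 1) (𝓡 1) ∞ fun v : Circle => v ^ k := by
  have hω : ContMDiff (𝓡 1) (𝓡 1) ω fun v : Circle => v ^ k := by
    cases k with
    | ofNat m => simpa using contMDiff_pow (I := 𝓡 1) (G := Circle) m
    | negSucc m => simpa using (contMDiff_pow (I := 𝓡 1) (G := Circle) (n := ω) (m + 1)).inv
  exact hω.of_le le_top

theorem contMDiff_linearTorusMap (A : Matrix (Fin 2) (Fin 2) ℤ) :
    ContMDiff ((𝓡 1).prod (𝓡 1)) ((𝓡 1).prod (𝓡 1)) ∞ (linearTorusMap A) := by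
  have hmul : ContMDiff ((𝓡 1).prod (𝓡 1)) (𝓡 1) ∞ fun p : Circle × Circle => p.1 * p.2 :=
    (contMDiff_mul (𝓡 1) ω).of_le le_top
  have h : ∀ a b : ℤ, ContMDiff ((𝓡 1).prod (𝓡 1)) (𝓡 1) ∞
      fun p : Torus => p.1 ^ a * p.2 ^ b := fun a b =>
    hmul.comp (((contMDiff_circle_zpow a).comp contMDiff_fst).prodMk
      ((contMDiff_circle_zpow b).comp contMDiff_snd))
  exact (h _ _).prodMk (h _ _)

/-- The linear diffeomorphism of the torus given by a matrix of determinant `1`. -/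
noncomputable def linearTorusDiffeo (A : Matrix.SpecialLinearGroup (Fin 2) ℤ) : TorusDiffeo where
  toFun := linearTorusMap A
  invFun := linearTorusMap (A⁻¹ : Matrix.SpecialLinearGroup (Fin 2) ℤ)
  left_inv p := by
    rw [← linearTorusMap_mul, ← Matrix.SpecialLinearGroup.coe_mul, inv_mul_cancel,
      Matrix.SpecialLinearGroup.coe_one, linearTorusMap_one]
  right_inv p := by
    rw [← linearTorusMap_mul, ← Matrix.SpecialLinearGroup.coe_mul, mul_inv_cancel,
      Matrix.SpecialLinearGroup.coe_one, linearTorusMap_one]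
  contMDiff_toFun := contMDiff_linearTorusMap _
  contMDiff_invFun := contMDiff_linearTorusMap _

theorem hasMatrix_linearTorusDiffeo (A : Matrix.SpecialLinearGroup (Fin 2) ℤ) :
    HasMatrix (linearTorusDiffeo A) A :=
  ContinuousMap.Homotopic.refl _

theorem HasMatrix.trans_linearTorusDiffeo_symm {φ : TorusDiffeo}
    {A : Matrix.SpecialLinearGroup (Fin 2) ℤ} (h : HasMatrix φ A)
    (B : Matrix.SpecialLinearGroup (Fin 2) ℤ) :
    HasMatrix (φ.trans (linearTorusDiffeo B).symm)
      (B⁻¹ * A : Matrix.SpecialLinearGroup (Fin 2) ℤ) := by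
  have hmul : linearTorusMap (B⁻¹ * A : Matrix.SpecialLinearGroup (Fin 2) ℤ) =
      (linearTorusMap (B⁻¹ : Matrix.SpecialLinearGroup (Fin 2) ℤ)).comp (linearTorusMap A) :=
    ContinuousMap.ext fun p => by
      rw [Matrix.SpecialLinearGroup.coe_mul]
      exact linearTorusMap_mul _ _ p
  rw [HasMatrix, hmul]
  exact (ContinuousMap.Homotopic.refl
    (linearTorusMap (B⁻¹ : Matrix.SpecialLinearGroup (Fin 2) ℤ))).comp h

end LinearTorusMap

/-! ### Radial extension of linear diffeomorphisms to the solid torus -/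

section Twist

/-- The direction `z / |z|` of a nonzero complex number; it is `1` for `z = 0`. -/
noncomputable def circleDir (z : ℂ) : Circle := Circle.exp z.arg

theorem norm_mul_circleDir (z : ℂ) : (‖z‖ : ℂ) * circleDir z = z := by
  simp [circleDir]

theorem circleDir_real_mul {r : ℝ} (hr : 0 < r) (u : Circle) : circleDir (r * u) = u := by
  rw [circleDir, Complex.arg_real_mul _ hr, Circle.exp_arg]

theorem circleDir_coe (u : Circle) : circleDir u = u := Circle.exp_arg u

theorem circleDir_eq_iff {z : ℂ} (hz : z ≠ 0) {u : Circle} :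
    circleDir z = u ↔ z = ‖z‖ * u := by
  constructor
  · rintro rfl
    exact (norm_mul_circleDir z).symm
  · intro h
    rw [h]
    exact circleDir_real_mul (norm_pos_iff.2 hz) u

theorem contMDiffOn_circleDir : ContMDiffOn 𝓘(ℝ, ℂ) (𝓡 1) ∞ circleDir {z | z ≠ 0} := by
  intro z₀ hz₀
  -- After a rotation by `w`, the point `z₀` lies on the positive real axis, where `arg` is smooth.
  set w : Circle := (circleDir z₀)⁻¹ with hw
  have hrot : ∀ z : ℂ, z ≠ 0 → circleDir z = w⁻¹ * circleDir (w * z) := by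
    intro z hz
    rw [eq_inv_mul_iff_mul_eq, eq_comm, circleDir_eq_iff (by simpa using hz)]
    push_cast
    rw [norm_mul, Circle.norm_coe, one_mul, mul_left_comm, norm_mul_circleDir]
  have hslit : (w * z₀ : ℂ) ∈ Complex.slitPlane := by
    have : (w * z₀ : ℂ) = (‖z₀‖ : ℝ) := by
      conv_lhs => rw [← norm_mul_circleDir z₀, hw]
      rw [mul_left_comm, ← Circle.coe_mul]
      simp
    rw [this]
    exact Complex.ofReal_mem_slitPlane.2 (norm_pos_iff.2 hz₀)
  have harg : ContDiffAt ℝ ∞ (fun z : ℂ => (w * z).arg) z₀ := by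
    have h1 : ContDiffAt ℝ ∞ Complex.log (w * z₀) :=
      (Complex.contDiffAt_log hslit).restrict_scalars ℝ
    have h2 : ContDiffAt ℝ ∞ (fun z : ℂ => (w : ℂ) * z) z₀ := contDiffAt_const.mul contDiffAt_id
    have h3 := (Complex.imCLM.contDiff (n := ∞)).contDiffAt.comp z₀ (h1.comp z₀ h2)
    simpa [Function.comp_def, Complex.log_im] using h3
  have hexp : ContMDiffAt 𝓘(ℝ, ℂ) (𝓡 1) ∞ (fun z : ℂ => circleDir (w * z)) z₀ :=
    contMDiff_circleExp.contMDiffAt.comp z₀ harg.contMDiffAt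
  have hmul : ContMDiff (𝓡 1) (𝓡 1) ∞ fun v : Circle => w⁻¹ * v :=
    (contMDiff_mul_left (I := 𝓡 1) (n := ω)).of_le le_top
  refine ((hmul.contMDiffAt.comp z₀ hexp).congr_of_eventuallyEq ?_).contMDiffWithinAt
  filter_upwards [isOpen_ne.mem_nhds hz₀] with z hz using hrot z hz

open Classical in
/-- The radial extension `(r u, v) ↦ (r u ^ a v ^ b, u ^ c v ^ d)` to `ℂ × S¹` of the linear map of
the torus, for `r > 0`. It is completed by the identity on the core `0 × S¹`, where it is in general
discontinuous. -/
noncomputable def twist (A : Matrix (Fin 2) (Fin 2) ℤ) (p : ℂ × Circle) : ℂ × Circle :=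
  if p.1 = 0 then p else
    ((‖p.1‖ : ℂ) * (linearTorusMap A (circleDir p.1, p.2)).1,
      (linearTorusMap A (circleDir p.1, p.2)).2)

theorem twist_of_ne_zero (A : Matrix (Fin 2) (Fin 2) ℤ) {p : ℂ × Circle} (hp : p.1 ≠ 0) :
    twist A p = ((‖p.1‖ : ℂ) * (linearTorusMap A (circleDir p.1, p.2)).1,
      (linearTorusMap A (circleDir p.1, p.2)).2) := if_neg hp

theorem twist_of_eq_zero (A : Matrix (Fin 2) (Fin 2) ℤ) {p : ℂ × Circle} (hp : p.1 = 0) :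
    twist A p = p := if_pos hp

theorem norm_twist_fst (A : Matrix (Fin 2) (Fin 2) ℤ) (p : ℂ × Circle) :
    ‖(twist A p).1‖ = ‖p.1‖ := by
  by_cases hp : p.1 = 0
  · rw [twist_of_eq_zero A hp]
  · simp [twist_of_ne_zero A hp, Circle.norm_coe]

theorem twist_fst_eq_zero_iff (A : Matrix (Fin 2) (Fin 2) ℤ) (p : ℂ × Circle) :
    (twist A p).1 = 0 ↔ p.1 = 0 := by
  rw [← norm_eq_zero, norm_twist_fst, norm_eq_zero]

theorem twist_coe (A : Matrix (Fin 2) (Fin 2) ℤ) (x : Torus) :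
    twist A ((x.1 : ℂ), x.2) = (((linearTorusMap A x).1 : ℂ), (linearTorusMap A x).2) := by
  rw [twist_of_ne_zero A (Circle.coe_ne_zero x.1)]
  simp [circleDir_coe, Circle.norm_coe]

theorem twist_one (p : ℂ × Circle) : twist 1 p = p := by
  by_cases hp : p.1 = 0
  · rw [twist_of_eq_zero _ hp]
  · rw [twist_of_ne_zero _ hp, linearTorusMap_one, norm_mul_circleDir]

theorem twist_mul (A B : Matrix (Fin 2) (Fin 2) ℤ) (p : ℂ × Circle) :
    twist (A * B) p = twist A (twist B p) := by
  by_cases hp : p.1 = 0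
  · simp only [twist_of_eq_zero _ hp]
  · have hdir : circleDir (twist B p).1 = (linearTorusMap B (circleDir p.1, p.2)).1 := by
      rw [twist_of_ne_zero B hp]
      exact circleDir_real_mul (norm_pos_iff.2 hp) _
    have hsnd : (twist B p).2 = (linearTorusMap B (circleDir p.1, p.2)).2 := by
      rw [twist_of_ne_zero B hp]
    rw [twist_of_ne_zero A (mt (twist_fst_eq_zero_iff B p).1 hp), twist_of_ne_zero _ hp,
      norm_twist_fst, hdir, hsnd, linearTorusMap_mul]

theorem contMDiffOn_twist (A : Matrix (Fin 2) (Fin 2) ℤ) :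
    ContMDiffOn (𝓘(ℝ, ℂ).prod (𝓡 1)) (𝓘(ℝ, ℂ).prod (𝓡 1)) ∞ (twist A) {p | p.1 ≠ 0} := by
  have hlin : ContMDiffOn (𝓘(ℝ, ℂ).prod (𝓡 1)) ((𝓡 1).prod (𝓡 1)) ∞
      (fun p : ℂ × Circle => linearTorusMap A (circleDir p.1, p.2)) {p | p.1 ≠ 0} :=
    (contMDiff_linearTorusMap A).comp_contMDiffOn
      ((contMDiffOn_circleDir.comp contMDiffOn_fst fun p hp => hp).prodMk contMDiffOn_snd)
  have hcoe : ContMDiff (𝓡 1) 𝓘(ℝ, ℂ) ∞ (fun u : Circle => (u : ℂ)) := by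
    have : Fact (Module.finrank ℝ ℂ = 1 + 1) := finrank_real_complex_fact'
    exact contMDiff_coe_sphere
  have hnorm : ContMDiffOn (𝓘(ℝ, ℂ).prod (𝓡 1)) 𝓘(ℝ, ℝ) ∞
      (fun p : ℂ × Circle => ‖p.1‖) {p | p.1 ≠ 0} := by
    have h : ContDiffOn ℝ ∞ (fun z : ℂ => ‖z‖) {z | z ≠ 0} := fun z hz =>
      (contDiffAt_norm ℝ hz).contDiffWithinAt
    exact h.contMDiffOn.comp contMDiffOn_fst fun p hp => hp
  have hfst := hcoe.comp_contMDiffOn (contMDiff_fst.comp_contMDiffOn hlin)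
  refine ((hnorm.smul hfst).prodMk (contMDiff_snd.comp_contMDiffOn hlin)).congr fun p hp => ?_
  rw [twist_of_ne_zero A hp]
  exact Prod.ext Complex.real_smul.symm rfl

/-- The radial extension of a linear diffeomorphism of the torus, as a bijection of `ℂ × S¹`. -/
noncomputable def twistEquiv (A : Matrix.SpecialLinearGroup (Fin 2) ℤ) :
    ℂ × Circle ≃ ℂ × Circle where
  toFun := twist A
  invFun := twist (A⁻¹ : Matrix.SpecialLinearGroup (Fin 2) ℤ)
  left_inv p := by
    rw [← twist_mul, ← Matrix.SpecialLinearGroup.coe_mul, inv_mul_cancel,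
      Matrix.SpecialLinearGroup.coe_one, twist_one]
  right_inv p := by
    rw [← twist_mul, ← Matrix.SpecialLinearGroup.coe_mul, mul_inv_cancel,
      Matrix.SpecialLinearGroup.coe_one, twist_one]

end Twist

/-! ### Linear surgery along a framed knot -/

namespace TubularNeighborhood

variable {M : ThreeManifold.{u}}

/-- A framed tubular neighbourhood as a bijection from `ℂ × S¹` to its image. -/
noncomputable def toPartialEquiv (h : TubularNeighborhood M) : PartialEquiv (ℂ × Circle) M :=
  h.injective.injOn.toPartialEquiv h.toFun univ

theorem toPartialEquiv_source (h : TubularNeighborhood M) : h.toPartialEquiv.source = univ := rfl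

theorem toPartialEquiv_target (h : TubularNeighborhood M) :
    h.toPartialEquiv.target = range h.toFun := image_univ

theorem toPartialEquiv_symm_apply (h : TubularNeighborhood M) (p : ℂ × Circle) :
    h.toPartialEquiv.symm (h.toFun p) = p := h.toPartialEquiv.left_inv (mem_univ p)

theorem isOpenMap (h : TubularNeighborhood M) : IsOpenMap h.toFun :=
  h.isLocalDiffeomorph.isLocalHomeomorph.isOpenMap

theorem contMDiff (h : TubularNeighborhood M) :
    ContMDiff (𝓘(ℝ, ℂ).prod (𝓡 1)) (𝓡 3) ∞ h.toFun := h.isLocalDiffeomorph.contMDiff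

theorem contMDiffOn_symm (h : TubularNeighborhood M) :
    ContMDiffOn (𝓡 3) (𝓘(ℝ, ℂ).prod (𝓡 1)) ∞ h.toPartialEquiv.symm (range h.toFun) := by
  rintro _ ⟨p, rfl⟩
  obtain ⟨Φ, hp, hΦ⟩ := h.isLocalDiffeomorph p
  have hmem : Φ.target ∈ 𝓝 (h.toFun p) :=
    Φ.open_target.mem_nhds (by rw [hΦ hp]; exact Φ.map_source hp)
  refine ((Φ.contMDiffOn_invFun.congr ?_).contMDiffAt hmem).contMDiffWithinAt
  intro y hy
  have : h.toFun (Φ.invFun y) = y := (hΦ (Φ.map_target hy)).trans (Φ.right_inv hy)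
  conv_lhs => rw [← this]
  exact h.toPartialEquiv_symm_apply _

theorem isCompact_solidTorus (h : TubularNeighborhood M) : IsCompact h.solidTorus := by
  refine IsCompact.image ?_ h.contMDiff.continuous
  have : {p : ℂ × Circle | ‖p.1‖ ≤ 1} = Metric.closedBall 0 1 ×ˢ univ := by
    ext p
    simp
  rw [this]
  exact (isCompact_closedBall _ _).prod isCompact_univ

theorem isClosed_knot (h : TubularNeighborhood M) : IsClosed h.knot := by
  refine (IsCompact.image ?_ h.contMDiff.continuous).isClosed
  have : {p : ℂ × Circle | p.1 = 0} = {0} ×ˢ univ := by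
    ext p
    simp
  rw [this]
  exact isCompact_singleton.prod isCompact_univ

theorem toFun_mem_knot (h : TubularNeighborhood M) {p : ℂ × Circle} :
    h.toFun p ∈ h.knot ↔ p.1 = 0 := h.injective.mem_set_image

theorem exterior_subset (h : TubularNeighborhood M) : h.exterior ⊆ h.knotᶜ := by
  refine compl_subset_compl.2 (image_mono fun p hp => ?_)
  simp only [mem_ofPred_eq] at hp ⊢
  simp [hp]

/-- The twist of the tubular neighbourhood by a matrix, as a bijection of the image of `h`. -/
noncomputable def twistPartialEquiv (h : TubularNeighborhood M)
    (A : Matrix.SpecialLinearGroup (Fin 2) ℤ) : PartialEquiv M M :=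
  (h.toPartialEquiv.symm.trans (twistEquiv A).toPartialEquiv).trans h.toPartialEquiv

theorem twistPartialEquiv_source (h : TubularNeighborhood M)
    (A : Matrix.SpecialLinearGroup (Fin 2) ℤ) :
    (h.twistPartialEquiv A).source = range h.toFun := by
  simp [twistPartialEquiv, PartialEquiv.trans_source, toPartialEquiv_target, toPartialEquiv_source]

theorem twistPartialEquiv_target (h : TubularNeighborhood M)
    (A : Matrix.SpecialLinearGroup (Fin 2) ℤ) :
    (h.twistPartialEquiv A).target = range h.toFun := by
  simp [twistPartialEquiv, PartialEquiv.trans_target, toPartialEquiv_target, toPartialEquiv_source]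

theorem twistPartialEquiv_apply (h : TubularNeighborhood M)
    (A : Matrix.SpecialLinearGroup (Fin 2) ℤ) (p : ℂ × Circle) :
    h.twistPartialEquiv A (h.toFun p) = h.toFun (twist A p) := by
  change h.toFun (twist A (h.toPartialEquiv.symm (h.toFun p))) = _
  rw [toPartialEquiv_symm_apply]

theorem twistPartialEquiv_symm_apply (h : TubularNeighborhood M)
    (A : Matrix.SpecialLinearGroup (Fin 2) ℤ) (p : ℂ × Circle) :
    (h.twistPartialEquiv A).symm (h.toFun p) =
      h.toFun (twist (A⁻¹ : Matrix.SpecialLinearGroup (Fin 2) ℤ) p) :=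
  h.twistPartialEquiv_apply A⁻¹ p

theorem isOpen_range_diff_knot (h : TubularNeighborhood M) :
    IsOpen (range h.toFun ∩ h.knotᶜ) :=
  h.isOpenMap.isOpen_range.inter h.isClosed_knot.isOpen_compl

theorem contMDiffOn_twistPartialEquiv (h : TubularNeighborhood M)
    (A : Matrix.SpecialLinearGroup (Fin 2) ℤ) :
    ContMDiffOn (𝓡 3) (𝓡 3) ∞ (h.twistPartialEquiv A) (range h.toFun ∩ h.knotᶜ) := by
  refine h.contMDiff.comp_contMDiffOn ((contMDiffOn_twist A).comp
    (h.contMDiffOn_symm.mono inter_subset_left) ?_)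
  rintro _ ⟨⟨p, rfl⟩, hp⟩
  change (h.toPartialEquiv.symm (h.toFun p)).1 ≠ 0
  rw [toPartialEquiv_symm_apply]
  exact fun h0 => hp (h.toFun_mem_knot.2 h0)

/-- The two pieces of the manifold obtained by a linear surgery along `h`, which is built on the
points of `M`: the complement of the knot with its given structure, and the image of `h`
parametrized by `h ∘ twist A` instead of `h`. -/
noncomputable def surgeryPiece (h : TubularNeighborhood M)
    (A : Matrix.SpecialLinearGroup (Fin 2) ℤ) : Bool → PartialEquiv M M
  | false => PartialEquiv.ofSet h.knotᶜ
  | true => (h.twistPartialEquiv A).symm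

theorem surgeryPiece_cover (h : TubularNeighborhood M)
    (A : Matrix.SpecialLinearGroup (Fin 2) ℤ) (x : M) : ∃ i, x ∈ (h.surgeryPiece A i).source := by
  by_cases hx : x ∈ h.knot
  · refine ⟨true, ?_⟩
    obtain ⟨p, -, rfl⟩ := hx
    change h.toFun p ∈ (h.twistPartialEquiv A).target
    exact (h.twistPartialEquiv_target A).symm ▸ mem_range_self p
  · exact ⟨false, hx⟩

theorem surgeryPiece_transition (h : TubularNeighborhood M)
    (A : Matrix.SpecialLinearGroup (Fin 2) ℤ) (i j : Bool) :
    IsOpen ((h.surgeryPiece A i).symm.trans (h.surgeryPiece A j)).source ∧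
      ContMDiffOn (𝓡 3) (𝓡 3) ∞ ((h.surgeryPiece A i).symm.trans (h.surgeryPiece A j))
        ((h.surgeryPiece A i).symm.trans (h.surgeryPiece A j)).source := by
  match i, j with
  | false, false =>
    have : ((h.surgeryPiece A false).symm.trans (h.surgeryPiece A false)).source = h.knotᶜ := by
      ext x
      simp [surgeryPiece]
    rw [this]
    exact ⟨h.isClosed_knot.isOpen_compl, contMDiffOn_id⟩
  | true, true =>
    have : ((h.surgeryPiece A true).symm.trans (h.surgeryPiece A true)).source =
        range h.toFun := by
      rw [← h.twistPartialEquiv_source A]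
      ext x
      simp +contextual [surgeryPiece]
    rw [this]
    refine ⟨h.isOpenMap.isOpen_range, contMDiffOn_id.congr fun x hx => ?_⟩
    rw [← h.twistPartialEquiv_source A] at hx
    exact (h.twistPartialEquiv A).left_inv hx
  | false, true =>
    have : ((h.surgeryPiece A false).symm.trans (h.surgeryPiece A true)).source =
        range h.toFun ∩ h.knotᶜ := by
      ext x
      simp [surgeryPiece, twistPartialEquiv_target, and_comm]
    rw [this]
    exact ⟨h.isOpen_range_diff_knot, h.contMDiffOn_twistPartialEquiv A⁻¹⟩
  | true, false =>
    have : ((h.surgeryPiece A true).symm.trans (h.surgeryPiece A false)).source =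
        range h.toFun ∩ h.knotᶜ := by
      ext x
      simp only [surgeryPiece, PartialEquiv.trans_source, PartialEquiv.symm_symm,
        PartialEquiv.ofSet_source, mem_inter_iff, mem_preimage,
        mem_compl_iff, twistPartialEquiv_source]
      refine and_congr_right ?_
      rintro ⟨p, rfl⟩
      rw [twistPartialEquiv_apply, toFun_mem_knot, toFun_mem_knot, twist_fst_eq_zero_iff]
    rw [this]
    exact ⟨h.isOpen_range_diff_knot, h.contMDiffOn_twistPartialEquiv A⟩

end TubularNeighborhood

/-- The set of points of a 3-manifold, without its topology and its smooth structure. -/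
def ThreeManifold.Points (M : ThreeManifold.{u}) : Type u := M

namespace Surgery

variable {M₁ M₂ : ThreeManifold.{u}}

/-- Surgery with a linear gluing map exists along every framed knot. -/
theorem exists_linear (h : TubularNeighborhood M₁) (A : Matrix.SpecialLinearGroup (Fin 2) ℤ) :
    ∃ (M' : ThreeManifold.{u}) (S : Surgery M₁ M'),
      S.source = h ∧ S.φ = linearTorusDiffeo A ∧ S.matrix = A := by
  -- The new manifold has the points of `M₁`; its structure is glued from the two pieces.
  let f : Bool → PartialEquiv M₁.Points M₁ := h.surgeryPiece A
  obtain ⟨tX, cX, mX, hF⟩ := exists_isManifold_of_pieces f (h.surgeryPiece_cover A)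
    (fun i j => (h.surgeryPiece_transition A i j).1) fun i j => (h.surgeryPiece_transition A i j).2
  choose F hF using hF
  have hsource : ∀ i, (F i).source = (f i).source := fun i => by rw [hF]
  have hsource₀ : (F false).source = h.knotᶜ := hsource false
  have hsource₁ : (F true).source = range h.toFun :=
    (hsource true).trans (h.twistPartialEquiv_target A)
  have hcov : ∀ x : M₁.Points, ∃ i, x ∈ (F i).toOpenPartialHomeomorph.source := fun x =>
    (h.surgeryPiece_cover A x).imp fun i hi => (hsource i).symm ▸ hi
  have hsc : SecondCountableTopology M₁.Points :=
    secondCountableTopology_of_openPartialHomeomorph_cover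
      (fun i => (F i).toOpenPartialHomeomorph) hcov
  have hF₀ : ∀ x, F false x = x := fun x => by
    rw [hF]
    rfl
  have hF₀' : ∀ x, (F false).symm x = x := fun x => by
    change (F false).toPartialEquiv.symm x = x
    rw [hF]
    rfl
  have hF₁ : ∀ p, F true (h.toFun p) =
      h.toFun (twist (A⁻¹ : Matrix.SpecialLinearGroup (Fin 2) ℤ) p) := fun p => by
    rw [hF]
    exact h.twistPartialEquiv_symm_apply A p
  have hF₁' : ∀ p, (F true).symm (h.toFun p) = h.toFun (twist A p) := fun p => by
    change (F true).toPartialEquiv.symm (h.toFun p) = _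
    rw [hF]
    exact h.twistPartialEquiv_apply A p
  -- A point of the knot is separated from a point off the image of `h` by the open solid torus.
  have hsep : ∀ x y : M₁.Points, x ∈ h.knot → y ∉ range h.toFun →
      ∃ u v : Set M₁.Points, IsOpen u ∧ IsOpen v ∧ x ∈ u ∧ y ∈ v ∧ Disjoint u v := by
    intro x y hx hy
    have hopen : IsOpen h.openSolidTorus :=
      h.isOpenMap _ (isOpen_lt (continuous_norm.comp continuous_fst) continuous_const)
    refine ⟨_, _, (F true).toOpenPartialHomeomorph.isOpen_inter_preimage hopen,
      (F false).toOpenPartialHomeomorph.isOpen_inter_preimage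
        h.isCompact_solidTorus.isClosed.isOpen_compl, ?_, ?_, ?_⟩
    · obtain ⟨p, hp, rfl⟩ := hx
      refine ⟨hsource₁.symm ▸ mem_range_self p, ?_⟩
      change F true (h.toFun p) ∈ h.openSolidTorus
      rw [hF₁]
      refine mem_image_of_mem _ ?_
      rw [mem_ofPred_eq] at hp ⊢
      rw [norm_twist_fst, hp, norm_zero]
      exact one_pos
    · refine ⟨hsource₀.symm ▸ fun hk => hy ?_, ?_⟩
      · obtain ⟨p, -, rfl⟩ := hk
        exact mem_range_self p
      · change F false y ∉ h.solidTorus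
        rw [hF₀]
        rintro ⟨p, -, rfl⟩
        exact hy (mem_range_self p)
    · rw [Set.disjoint_left]
      rintro z ⟨hz, hz'⟩ ⟨-, hz''⟩
      change F true z ∈ h.openSolidTorus at hz'
      change F false z ∉ h.solidTorus at hz''
      rw [hF₀] at hz''
      obtain ⟨p, rfl⟩ := hsource₁.subset hz
      rw [hF₁] at hz'
      obtain ⟨q, hq, hqp⟩ := hz'
      rw [h.injective hqp, mem_ofPred_eq, norm_twist_fst] at hq
      exact hz'' (mem_image_of_mem _ hq.le)
  have ht2 : T2Space M₁.Points := by
    refine ⟨fun x y hxy => ?_⟩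
    by_cases hx : x ∈ h.knot
    · by_cases hy : y ∈ range h.toFun
      · refine (F true).toOpenPartialHomeomorph.exists_separation (hsource₁.symm ▸ ?_)
          (hsource₁.symm ▸ hy) hxy
        obtain ⟨p, -, rfl⟩ := hx
        exact mem_range_self p
      · exact hsep x y hx hy
    · by_cases hy : y ∈ h.knot
      · by_cases hx' : x ∈ range h.toFun
        · refine (F true).toOpenPartialHomeomorph.exists_separation (hsource₁.symm ▸ hx')
            (hsource₁.symm ▸ ?_) hxy
          obtain ⟨p, -, rfl⟩ := hy
          exact mem_range_self p
        · obtain ⟨u, v, hu, hv, hyu, hxv, huv⟩ := hsep y x hy hx'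
          exact ⟨v, u, hv, hu, hxv, hyu, huv.symm⟩
      · exact (F false).toOpenPartialHomeomorph.exists_separation (hsource₀.symm ▸ hx)
          (hsource₀.symm ▸ hy) hxy
  let M' : ThreeManifold.{u} := ⟨M₁.Points⟩
  let target : TubularNeighborhood M' :=
    { toFun := fun p => (h.toFun (twist A p) : M₁)
      injective := h.injective.comp (twistEquiv A).injective
      isLocalDiffeomorph := fun p => by
        have h1 : IsLocalDiffeomorphAt (𝓡 3) (𝓡 3) ∞ (F true).symm (h.toFun p) := by
          refine (F true).symm.isLocalDiffeomorphAt _ _ _ ?_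
          have : (F true).target = range h.toFun := by
            rw [hF]
            exact h.twistPartialEquiv_source A
          change h.toFun p ∈ (F true).target
          exact this.symm ▸ mem_range_self p
        have h2 := (h.isLocalDiffeomorph p).comp (K := 𝓡 3) (P := M₁.Points) h1
        have h3 : ((F true).symm ∘ h.toFun : ℂ × Circle → M₁.Points) =
            fun p => h.toFun (twist A p) := funext hF₁'
        rw [h3] at h2
        exact h2 }
  have hext : target.exterior = h.exterior := by
    refine congrArg compl ?_
    change (fun p => h.toFun (twist A p)) '' {p | ‖p.1‖ < 1} = h.toFun '' {p | ‖p.1‖ < 1}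
    ext y
    constructor
    · rintro ⟨p, hp, rfl⟩
      exact ⟨twist A p, (norm_twist_fst A p).trans_lt hp, rfl⟩
    · rintro ⟨p, hp, rfl⟩
      exact ⟨(twistEquiv A).symm p, (norm_twist_fst _ p).trans_lt hp,
        congrArg h.toFun ((twistEquiv A).apply_symm_apply p)⟩
  have hsub : h.exterior ⊆ (F false).target := by
    rw [hF]
    exact h.exterior_subset
  let S : Surgery M₁ M' :=
    { source := h
      φ := linearTorusDiffeo A
      matrix := A
      hasMatrix := hasMatrix_linearTorusDiffeo A
      target := target
      ext := PartialEquiv.ofSet h.exterior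
      ext_source := rfl
      ext_target := hext.symm
      contMDiffOn_ext :=
        ((F false).contMDiffOn_invFun.mono hsub).congr fun x _ => (hF₀' x).symm
      contMDiffOn_ext_symm :=
        ((F false).contMDiffOn_toFun.mono (h.exterior_subset.trans hsource₀.superset)).congr
          fun x _ => (hF₀ x).symm
      glue := fun x => congrArg h.toFun (twist_coe _ x).symm }
  exact ⟨M', S, rfl, rfl, rfl⟩

end Surgery

/-! ### Splitting off a linear surgery -/

namespace Surgery

variable {M₁ M₂ : ThreeManifold.{u}}

/-- From every surgery, a linear surgery with any prescribed matrix `B` can be split off as a first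
step. No isotopy of the gluing map to a linear one is needed, because the second step absorbs the
difference. -/
theorem exists_isComposite (S : Surgery M₁ M₂) (B : Matrix.SpecialLinearGroup (Fin 2) ℤ) :
    ∃ (M' : ThreeManifold.{u}) (S₁ : Surgery M₁ M') (S₂ : Surgery M' M₂),
      S₁.matrix = B ∧ S₂.matrix = B⁻¹ * S.matrix ∧ IsComposite S₁ S₂ S := by
  obtain ⟨M', S₁, hsource, hφ, hB⟩ := exists_linear S.source B
  have hN : S₁.ext.source = S.ext.source := by rw [S₁.ext_source, S.ext_source, hsource]
  have hE : (S₁.ext.symm.trans S.ext).source = S₁.ext.target := by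
    ext x
    simp only [PartialEquiv.trans_source, PartialEquiv.symm_source, mem_inter_iff, mem_preimage,
      and_iff_left_iff_imp, ← hN]
    exact fun hx => S₁.ext.map_target hx
  have hE' : (S₁.ext.symm.trans S.ext).target = S.ext.target := by
    ext x
    simp only [PartialEquiv.trans_target, PartialEquiv.symm_target, mem_inter_iff, mem_preimage,
      and_iff_left_iff_imp, hN]
    exact fun hx => S.ext.map_target hx
  let S₂ : Surgery M' M₂ :=
    { source := S₁.target
      φ := S.φ.trans (linearTorusDiffeo B).symm
      matrix := B⁻¹ * S.matrix
      hasMatrix := S.hasMatrix.trans_linearTorusDiffeo_symm B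
      target := S.target
      ext := S₁.ext.symm.trans S.ext
      ext_source := hE.trans S₁.ext_target
      ext_target := hE'.trans S.ext_target
      contMDiffOn_ext := by
        rw [hE]
        exact S.contMDiffOn_ext.comp S₁.contMDiffOn_ext_symm fun x hx =>
          hN ▸ S₁.ext.map_target hx
      contMDiffOn_ext_symm := by
        rw [hE']
        exact S₁.contMDiffOn_ext.comp S.contMDiffOn_ext_symm fun x hx =>
          hN ▸ S.ext.map_target hx
      glue := fun x => by
        have hx := S₁.glue ((linearTorusDiffeo B).symm (S.φ x))
        rw [hφ, Diffeomorph.apply_symm_apply, hsource] at hx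
        have hmem : S.source.boundary (S.φ x) ∈ S₁.ext.source := by
          rw [hN, S.ext_source]
          rintro ⟨p, hp, hpx⟩
          rw [S.source.injective hpx, mem_ofPred_eq, Circle.norm_coe] at hp
          exact lt_irrefl _ hp
        change S.ext (S₁.ext.symm (S₁.target.boundary ((linearTorusDiffeo B).symm (S.φ x)))) = _
        rw [← hx, S₁.ext.left_inv hmem, S.glue] }
  refine ⟨M', S₁, S₂, hB, rfl, hsource.symm, rfl, rfl, fun x hx => ?_⟩
  change S.ext x = S.ext (S₁.ext.symm (S₁.ext x))
  rw [S₁.ext.left_inv (by rwa [hN, S.ext_source])]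

/-- If `|c| = 2`, then `a` is odd because the determinant is `1`, so `a / c` is a half-integer. -/
theorem isTopologicalFlop_of_natAbs_c (S : Surgery M₁ M₂) (hc : S.c.natAbs = 2) :
    S.IsTopologicalFlop := by
  have hdet : S.a * S.matrix 1 1 - S.matrix 0 1 * S.c = 1 := by
    have := S.matrix.det_coe
    rwa [Matrix.det_fin_two] at this
  have hodd : Odd S.a := by
    rw [← Int.not_even_iff_odd]
    rintro ⟨k, hk⟩
    rw [hk] at hdet
    rcases Int.natAbs_eq_iff.1 hc with h | h <;> rw [h] at hdet <;> push_cast at hdet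
    · have : 2 * (k * S.matrix 1 1 - S.matrix 0 1) = 1 := by linear_combination hdet
      omega
    · have : 2 * (k * S.matrix 1 1 + S.matrix 0 1) = 1 := by linear_combination hdet
      omega
  refine ⟨fun h => by simp [h] at hc, ?_⟩
  obtain ⟨k, hk⟩ := hodd
  have hcoe : ∀ m : ℤ, ((1 / 2 + m : ℚ) : AddCircle (1 : ℚ)) = (1 / 2 : ℚ) := fun m => by
    rw [AddCircle.coe_add, (AddCircle.coe_eq_zero_iff (x := (m : ℚ)) 1).2 ⟨m, zsmul_one m⟩, add_zero]
  rw [coefficient, hk]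
  rcases Int.natAbs_eq_iff.1 hc with h | h <;> rw [h]
  · rw [← hcoe k]
    congr 1
    push_cast
    ring
  · rw [← hcoe (-k - 1)]
    congr 1
    push_cast
    ring

end Surgery

/-! ### Factorization into matrices of flops -/

/-- The matrix with rows `(2 m + 1, m)` and `(2, 1)`: the gluing matrix of a topological flop, whose
entry `a` can be any odd number. -/
def flopMatrix (m : ℤ) : Matrix.SpecialLinearGroup (Fin 2) ℤ :=
  ⟨!![2 * m + 1, m; 2, 1], by rw [Matrix.det_fin_two_of]; ring⟩

theorem flopMatrix_inv_mul_apply (m : ℤ) (A : Matrix.SpecialLinearGroup (Fin 2) ℤ) :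
    ((flopMatrix m)⁻¹ * A) 1 0 = (2 * m + 1) * A 1 0 - 2 * A 0 0 := by
  rw [Matrix.SpecialLinearGroup.coe_mul, Matrix.SpecialLinearGroup.coe_inv,
    Matrix.adjugate_fin_two, Matrix.mul_apply, Fin.sum_univ_two]
  simp [flopMatrix]
  ring

/-- The step of the Euclidean algorithm: splitting off a suitable flop matrix decreases `|c|` when
`|c| > 2`. Strictness holds since equality would make `c` divide `2 a`, hence `2`, for the coprime
entries `a` and `c` of the first column. -/
theorem exists_natAbs_flopMatrix_inv_mul_lt (A : Matrix.SpecialLinearGroup (Fin 2) ℤ)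
    (hc : 2 < (A 1 0).natAbs) :
    ∃ m : ℤ, (((flopMatrix m)⁻¹ * A) 1 0).natAbs < (A 1 0).natAbs := by
  have hdet : A 0 0 * A 1 1 - A 0 1 * A 1 0 = 1 := by
    have := A.det_coe
    rwa [Matrix.det_fin_two] at this
  simp only [flopMatrix_inv_mul_apply]
  generalize A 0 0 = a, A 1 0 = c, A 0 1 = b, A 1 1 = d at *
  have hndvd : ¬ c ∣ 2 * a := by
    intro h
    have h2 : c ∣ 2 := by
      have : (2 : ℤ) = 2 * a * d - c * (2 * b) := by linear_combination (-2) * hdet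
      rw [this]
      exact dvd_sub (h.mul_right d) (dvd_mul_right c _)
    have := Nat.le_of_dvd two_pos (Int.natAbs_dvd_natAbs.2 h2)
    omega
  have hr : 2 * a = c * (2 * a / c) + 2 * a % c := (Int.mul_ediv_add_emod (2 * a) c).symm
  have hr0 : 2 * a % c ≠ 0 := fun h => hndvd (Int.dvd_of_emod_eq_zero h)
  have hc0 : c ≠ 0 := by rintro rfl; simp at hc
  have hrpos := Int.emod_nonneg (2 * a) hc0
  have hrlt := Int.emod_lt_abs (2 * a) hc0
  rw [Int.abs_eq_natAbs] at hrlt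
  generalize 2 * a % c = r, 2 * a / c = q at *
  -- With `2 a = c q + r` and `0 < r < |c|`, the odd number `2 m + 1` is taken to be `q` or `q ± 1`, so
  -- that the new entry is `-r` or `|c| - r`.
  rcases Int.even_or_odd' q with ⟨k, rfl | rfl⟩
  · rcases lt_or_gt_of_ne hc0 with hneg | hpos
    · refine ⟨k - 1, ?_⟩
      rw [show (2 * (k - 1) + 1) * c - 2 * a = -c - r by rw [hr]; ring]
      omega
    · refine ⟨k, ?_⟩
      rw [show (2 * k + 1) * c - 2 * a = c - r by rw [hr]; ring]
      omega
  · refine ⟨k, ?_⟩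
    rw [show (2 * k + 1) * c - 2 * a = -r by rw [hr]; ring]
    omega

theorem mainTheorem8 {M₁ M₂ : ThreeManifold.{u}} (S : Surgery M₁ M₂)
    (hS : S.IsTrivialModTwo) : S.IsCompositeOfFlops := by
  -- Induction on `|c|`: a flop with `c = 2` is split off. The remaining surgery is again trivial
  -- mod 2; it is a flop when `c = 0`, and has smaller `|c|` when `|c| > 2`.
  induction hn : S.c.natAbs using Nat.strong_induction_on generalizing M₁ M₂ with
  | _ n ih =>
    subst hn
    have hdvd : (2 : ℤ) ∣ S.matrix 1 0 := Int.modEq_zero_iff_dvd.1 hS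
    by_cases h2 : S.c.natAbs = 2
    · exact .flop S (S.isTopologicalFlop_of_natAbs_c h2)
    · obtain ⟨m, hm⟩ : ∃ m : ℤ, (((flopMatrix m)⁻¹ * S.matrix) 1 0).natAbs = 2 ∨
          (((flopMatrix m)⁻¹ * S.matrix) 1 0).natAbs < S.c.natAbs := by
        by_cases h0 : S.c = 0
        · have h0' : S.matrix 1 0 = 0 := h0
          have hdet := S.matrix.det_coe
          rw [Matrix.det_fin_two, h0', mul_zero, sub_zero] at hdet
          refine ⟨0, Or.inl ?_⟩
          rw [flopMatrix_inv_mul_apply, h0', mul_zero, zero_sub, Int.natAbs_neg, Int.natAbs_mul,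
            Int.isUnit_iff_natAbs_eq.1 (IsUnit.of_mul_eq_one _ hdet)]
          rfl
        · have h0' : S.matrix 1 0 ≠ 0 := h0
          have h2' : (S.matrix 1 0).natAbs ≠ 2 := h2
          obtain ⟨m, hm⟩ := exists_natAbs_flopMatrix_inv_mul_lt S.matrix (by omega)
          exact ⟨m, Or.inr hm⟩
      obtain ⟨M', S₁, S₂, h₁, h₂, hcomp⟩ := S.exists_isComposite (flopMatrix m)
      refine .comp S₁ S₂ S (.flop S₁ (S₁.isTopologicalFlop_of_natAbs_c ?_)) ?_ hcomp
      · rw [Surgery.c, h₁]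
        rfl
      · rw [← h₂] at hm
        rcases hm with hm | hm
        · exact .flop S₂ (S₂.isTopologicalFlop_of_natAbs_c hm)
        · refine ih _ hm S₂ ?_ rfl
          refine Int.modEq_zero_iff_dvd.2 ?_
          rw [Surgery.c, h₂, flopMatrix_inv_mul_apply]
          exact dvd_sub (hdvd.mul_left _) (dvd_mul_right 2 _)
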